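/- Throughout, $\mathbb N=\{0,1,2,\dots\}$, $\varphi^{(m)}$ denotes the $m$-fold iterate of a function $\varphi$, and $\varphi^M(n)$ denotes the maximum of $\varphi(i)$ over all $i\le n$ in the domain of $\varphi$ ($i\ge 0$ for the functions $h,\tilde g$ on $\mathbb N$; $i\ge 1$ for the functions $f,f_i$, which are regarded as functions on the positive integers). **Theorem.** Let $H$ be a real Hilbert space, $d\ge 1$ an integer, and $C\subseteq H$ a bounded closed convex set with $\operatorname{diam} C\le d$. Let $T:C\to C$ be nonexpansive and let $\mathcal G:C\to C$ be a strict contraction with Lipschitz constant $\tau\in[0,1)$. Let $(\lambda_n)_{n\ge 0}$ be a sequence in $(0,1]$, let $h:\mathbb N\to\{1,2,\dots\}$ satisfy $\lambda_n\ge 1/h(n)$ for all $n$, and let $\chi:\mathbb N\to\mathbb N$ be a rate of convergence of $(\lambda_n)$ towards $0$, i.e. $\lambda_i\le\frac1{n+1}$ for all $n\in\mathbb N$ and all $i\ge\chi(n)$. Suppose that $\phi_1,\phi_2:(0,\infty)\to\mathbb N$ satisfy (i) $\sum_{i=1}^{\phi_1(k)}\lambda_i\ge k$ for all real $k>0$,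 and (ii) $\dfrac{|\lambda_n-\lambda_{n+1}|}{\lambda_{n+1}^2}\le\varepsilon$ for all $\varepsilon>0$ and all $n\ge\phi_2(\varepsilon)$. Let $u_0\in C$ be arbitrary and $u_{n+1}:=(1-\lambda_{n+1})Tu_n+\lambda_{n+1}\mathcal G(Tu_n)$. Then for all $\varepsilon\in(0,1]$ and all $g:\mathbb N\to\mathbb N$ there exists an $$n\le\Xi(\varepsilon/6,g_c,\chi,h,d)+c$$ such that $\|u_i-u_j\|\le\varepsilon$ for all $i,j\in\{n,n+1,\dots,n+g(n)\}$. Here $$c:=\phi_1\!\left(\frac{\phi_2\big((1-\tau)^2\varepsilon/(6d)\big)+\log(6d/\varepsilon)}{1-\tau}\right),\qquad g_c(n):=n+c+g(n+c),$$ and, for $\varepsilon\in(0,1]$ and $g:\mathbb N\to\mathbb N$, $$\Xi(\varepsilon,g,\chi,h,d):=\chi\big(d\cdot k_{i_0}\big),$$ where $$\tilde g(n):=\max\{n,g(n)\},\qquad f(n):=\left\lceil\frac{6d\,h^M\big(\tilde g^M(\chi(dn))\big)}{(1-\tau)(\varepsilon/2)^2}\right\rceil,\qquad \tilde f(n):=\max\{f^M(16dn^2),16dn^2\},$$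 $$\varepsilon_d:=\frac{(1-\tau)^2(\varepsilon/2)^4}{8d^2},\qquad \tilde\varepsilon:=\frac{(1-\tau)^2}{6+8d}\,\varepsilon_d,\qquad n_{\tilde\varepsilon}:=\left\lceil\frac{8d^4}{\tilde\varepsilon^4}\right\rceil,\qquad i_0:=\left\lceil\log_\tau\!\big(\tilde\varepsilon/(6d^2)\big)-1\right\rceil$$ (with $i_0:=0$ if $\tau=0$), and, for $i\ge 0$, $$f_i:=\tilde f^{(n_{\tilde\varepsilon}^{\,i})},\qquad \tilde f_i(n):=\max\{f_i^M(16dn^2),16dn^2\},\qquad k_0:=\tilde f_0^{(n_{\tilde\varepsilon})}(1),\qquad k_{i+1}:=\tilde f_i^{(n_{\tilde\varepsilon})}(k_i).$$ -/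

import Mathlib

namespace HSDM

/-- `φ^M (n) = max {φ i : 0 ≤ i ≤ n}`, for a function on the nonnegative integers. -/
def runMax (φ : ℕ → ℕ) (n : ℕ) : ℕ := (Finset.range (n + 1)).sup φ

/-- `φ^M (n) = max {φ i : 1 ≤ i ≤ n}`, for a function on the positive integers
(the value at `0` is never used). -/
def runMaxPos (φ : ℕ → ℕ) (n : ℕ) : ℕ := (Finset.Icc 1 n).sup φ

/-- The operation `φ ↦ φ~`, `φ~ (n) = max {φ^M (16 d n²), 16 d n²}`. -/
def tilde (d : ℕ) (φ : ℕ → ℕ) (n : ℕ) : ℕ :=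
  max (runMaxPos φ (16 * d * n ^ 2)) (16 * d * n ^ 2)

/-- `g~ (n) = max {n, g n}`. -/
def gTilde (g : ℕ → ℕ) (n : ℕ) : ℕ := max n (g n)

/-- `ε_d = (1 - τ)² (ε / 2)⁴ / (8 d²)`. -/
noncomputable def epsD (τ ε : ℝ) (d : ℕ) : ℝ :=
  (1 - τ) ^ 2 * (ε / 2) ^ 4 / (8 * (d : ℝ) ^ 2)

/-- `ε~ = (1 - τ)² / (6 + 8 d) * ε_d`. -/
noncomputable def epsTilde (τ ε : ℝ) (d : ℕ) : ℝ :=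
  (1 - τ) ^ 2 / (6 + 8 * (d : ℝ)) * epsD τ ε d

/-- `N = ⌈8 d⁴ / ε~⁴⌉`. -/
noncomputable def numIter (τ ε : ℝ) (d : ℕ) : ℕ :=
  ⌈8 * (d : ℝ) ^ 4 / epsTilde τ ε d ^ 4⌉₊

/-- `i₀ = ⌈log_τ (ε~ / (6 d²)) - 1⌉`. For `0 < τ < 1` the number under the ceiling is `> -1`, so
this is the usual ceiling; for `τ = 0` the value is `0`. -/
noncomputable def depth (τ ε : ℝ) (d : ℕ) : ℕ :=
  ⌈Real.logb τ (epsTilde τ ε d / (6 * (d : ℝ) ^ 2)) - 1⌉₊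

/-- `f (n) = ⌈6 d h^M (g~^M (χ (d n))) / ((1 - τ) (ε / 2)²)⌉`. -/
noncomputable def fMaj (τ ε : ℝ) (g χ h : ℕ → ℕ) (d n : ℕ) : ℕ :=
  ⌈6 * (d : ℝ) * (runMax h (runMax (gTilde g) (χ (d * n))) : ℝ) / ((1 - τ) * (ε / 2) ^ 2)⌉₊

/-- `k₀ = (f₀~)^(N) (1)` and `k_{i+1} = (f_i~)^(N) (k_i)`, where `f_i = F^(N^i)` and where `F^(m)`
is the `m`-fold iterate. -/
def kSeq (N d : ℕ) (F : ℕ → ℕ) : ℕ → ℕ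
  | 0 => (tilde d (F^[N ^ 0]))^[N] 1
  | i + 1 => (tilde d (F^[N ^ i]))^[N] (kSeq N d F i)

/-- `Ξ (ε, g, χ, h, d) = χ (d * k_{i₀} (f~))`; it also depends on the contraction constant `τ`. -/
noncomputable def Xi (τ ε : ℝ) (g χ h : ℕ → ℕ) (d : ℕ) : ℕ :=
  χ (d * kSeq (numIter τ ε d) d (tilde d (fMaj τ ε g χ h d)) (depth τ ε d))

/-- `c = φ₁ ((φ₂ ((1 - τ)² ε / (6 d)) + log (6 d / ε)) / (1 - τ))`. -/
noncomputable def shiftConst (τ ε : ℝ) (d : ℕ) (φ₁ φ₂ : ℝ → ℕ) : ℕ :=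
  φ₁ (((φ₂ ((1 - τ) ^ 2 * ε / (6 * (d : ℝ))) : ℝ) + Real.log (6 * (d : ℝ) / ε)) / (1 - τ))

/-- `g_c (n) = n + c + g (n + c)`. -/
def shiftFun (c : ℕ) (g : ℕ → ℕ) (n : ℕ) : ℕ := n + c + g (n + c)

end HSDM

/-!
For `t ∈ (0, 1]` let `v t` be the point of `C` with `v t = (1 - t) T (v t) + t G (T (v t))`. The
iteration `u` tracks the points `v (l n)`: condition (ii) bounds the drift from `v (l n)` to
`v (l (n + 1))` and condition (i) makes the error contract, so that `‖u n - v (l n)‖ ≤ ε / 3` for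
`n ≥ c` (`norm_sub_implicit_le`). It remains to find a long interval of indices on which
`v (l n)` is almost constant.

For a fixed anchor `a`, the Browder points `w t = (1 - t) T (w t) + t a` satisfy
`‖w t - w s‖² ≤ ‖w s - a‖² - ‖w t - a‖²` for `s ≤ t` (`norm_sq_browder_sub_le`). Hence
`‖w t - a‖²` increases as `t` decreases and stays below `d²`, and among sufficiently many
consecutive intervals of parameters there is one on which `w` is almost constant
(`exists_browder_almost_constant`). Viscosity is reduced to this by Banach iteration: `v t` is the
Browder point with anchor `G (T (v t))`, and Browder points depend nonexpansively on the anchor, so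
if `v` stays within `R` of a point `b` on some interval, then on a suitable subinterval it stays
within `τ R + δ` of the almost constant value of the Browder points with anchor `G (T b)`.
Dividing each time into `M` parts, `L` such steps take `M ^ L` consecutive intervals and leave the
radius `τ ^ L d + δ / (1 - τ)` (`exists_implicit_almost_constant`).

The intervals used are `[1 / F^[j + 1] 1, 1 / F^[j] 1]` with `F = f~`. The function `f` grows so
fast that the parameters `l i`, with `i` between an index `n` that is at most `χ (d * F^[j] 1)` and
`g n`, all lie in one of them, and `k_{i₀}` dominates `F^[j] 1` for all relevant `j`
(`iterate_le_kSeq`), which gives the bound `Ξ`.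
-/

namespace HSDM

/-! ### Fixed points and Browder points -/

section Hilbert

variable {H : Type*} [NormedAddCommGroup H]

theorem exists_fixedPoint_of_contraction [CompleteSpace H] {C : Set H} (hC : IsClosed C)
    {Φ : H → H} (hΦC : Set.MapsTo Φ C C) {K : ℝ} (hK0 : 0 ≤ K) (hK1 : K < 1)
    (hΦ : ∀ x ∈ C, ∀ y ∈ C, ‖Φ x - Φ y‖ ≤ K * ‖x - y‖) {x₀ : H} (hx₀ : x₀ ∈ C) :
    ∃ y ∈ C, y = Φ y := by
  have hc : ContractingWith ⟨K, hK0⟩ (hΦC.restrict Φ C C) := by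
    refine ⟨by exact_mod_cast hK1, LipschitzWith.of_dist_le_mul fun x y => ?_⟩
    simp only [Subtype.dist_eq, dist_eq_norm]
    exact hΦ x x.2 y y.2
  obtain ⟨y, hy, hfix, -⟩ :=
    ContractingWith.exists_fixedPoint' hC.isComplete hΦC hc hx₀ (edist_ne_top _ _)
  exact ⟨y, hy, hfix.symm⟩

variable [InnerProductSpace ℝ H]

theorem mapsTo_convexCombination {C : Set H} (hCconvex : Convex ℝ C) {S₁ S₂ : H → H}
    (h₁ : Set.MapsTo S₁ C C) (h₂ : Set.MapsTo S₂ C C) {t : ℝ} (ht : t ∈ Set.Ioc (0 : ℝ) 1) :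
    Set.MapsTo (fun x => (1 - t) • S₁ x + t • S₂ x) C C := fun _ hx =>
  hCconvex (h₁ hx) (h₂ hx) (by linarith [ht.2]) ht.1.le (by ring)

/-- For `t > 0` the map `(1 - t) T + t S` contracts by the factor `1 - t (1 - τ)`. -/
theorem norm_convexCombination_sub_le {C : Set H} {T S : H → H} {τ : ℝ}
    (hT : ∀ x ∈ C, ∀ y ∈ C, ‖T x - T y‖ ≤ ‖x - y‖)
    (hS : ∀ x ∈ C, ∀ y ∈ C, ‖S x - S y‖ ≤ τ * ‖x - y‖) {t : ℝ} (ht : t ∈ Set.Ioc (0 : ℝ) 1)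
    {x y : H} (hx : x ∈ C) (hy : y ∈ C) :
    ‖((1 - t) • T x + t • S x) - ((1 - t) • T y + t • S y)‖ ≤ (1 - t * (1 - τ)) * ‖x - y‖ := by
  have e : ((1 - t) • T x + t • S x) - ((1 - t) • T y + t • S y)
      = (1 - t) • (T x - T y) + t • (S x - S y) := by module
  have h1 : 0 ≤ 1 - t := by linarith [ht.2]
  rw [e]
  refine (norm_add_le _ _).trans ?_
  rw [norm_smul, norm_smul, Real.norm_of_nonneg h1, Real.norm_of_nonneg ht.1.le]
  have a := mul_le_mul_of_nonneg_left (hT x hx y hy) h1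
  have b := mul_le_mul_of_nonneg_left (hS x hx y hy) ht.1.le
  linarith

theorem exists_convexCombination_fixedPoint [CompleteSpace H] {C : Set H} (hCclosed : IsClosed C)
    (hCconvex : Convex ℝ C) {T S : H → H} (hTC : Set.MapsTo T C C) (hSC : Set.MapsTo S C C)
    {τ : ℝ} (hτ0 : 0 ≤ τ) (hτ1 : τ < 1)
    (hT : ∀ x ∈ C, ∀ y ∈ C, ‖T x - T y‖ ≤ ‖x - y‖)
    (hS : ∀ x ∈ C, ∀ y ∈ C, ‖S x - S y‖ ≤ τ * ‖x - y‖)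
    {x₀ : H} (hx₀ : x₀ ∈ C) {t : ℝ} (ht : t ∈ Set.Ioc (0 : ℝ) 1) :
    ∃ y ∈ C, y = (1 - t) • T y + t • S y :=
  exists_fixedPoint_of_contraction hCclosed (mapsTo_convexCombination hCconvex hTC hSC ht)
    (K := 1 - t * (1 - τ)) (by nlinarith [ht.1, ht.2])
    (by nlinarith [ht.1])
    (fun _ hx _ hy => norm_convexCombination_sub_le hT hS ht hx hy) hx₀

/-- Browder points depend nonexpansively on the anchor. -/
theorem norm_browder_sub_le_of_anchors {C : Set H} {T : H → H}
    (hT : ∀ x ∈ C, ∀ y ∈ C, ‖T x - T y‖ ≤ ‖x - y‖) {t : ℝ} (ht : t ∈ Set.Ioc (0 : ℝ) 1)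
    {a b x y : H} (hx : x ∈ C) (hy : y ∈ C)
    (hxa : x = (1 - t) • T x + t • a) (hyb : y = (1 - t) • T y + t • b) :
    ‖x - y‖ ≤ ‖a - b‖ := by
  have h1 : 0 ≤ 1 - t := by linarith [ht.2]
  have e : x - y = (1 - t) • (T x - T y) + t • (a - b) := by
    calc x - y = ((1 - t) • T x + t • a) - ((1 - t) • T y + t • b) := by rw [← hxa, ← hyb]
      _ = _ := by module
  have hn : ‖x - y‖ ≤ (1 - t) * ‖T x - T y‖ + t * ‖a - b‖ := by
    calc ‖x - y‖ = ‖(1 - t) • (T x - T y) + t • (a - b)‖ := by rw [← e]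
      _ ≤ _ := norm_add_le _ _
      _ = _ := by rw [norm_smul, norm_smul, Real.norm_of_nonneg h1, Real.norm_of_nonneg ht.1.le]
  have := mul_le_mul_of_nonneg_left (hT x hx y hy) h1
  refine le_of_mul_le_mul_left ?_ ht.1
  linarith

/-- For two Browder points with the same anchor, the squared distances to the anchor control the
distance between the points; this is a consequence of the monotonicity of `I - T`. -/
theorem norm_sq_browder_sub_le {C : Set H} {T : H → H}
    (hT : ∀ x ∈ C, ∀ y ∈ C, ‖T x - T y‖ ≤ ‖x - y‖) {s t : ℝ} (hs : 0 < s) (hst : s ≤ t)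
    (ht1 : t ≤ 1) {a x y : H} (hx : x ∈ C) (hy : y ∈ C)
    (hxa : x = (1 - t) • T x + t • a) (hya : y = (1 - s) • T y + s • a) :
    ‖x - y‖ ^ 2 ≤ ‖y - a‖ ^ 2 - ‖x - a‖ ^ 2 := by
  rcases eq_or_lt_of_le hst with rfl | hlt
  · have := norm_browder_sub_le_of_anchors hT ⟨hs, ht1⟩ hx hy hxa hya
    have hxy : x = y := by simpa [sub_eq_zero] using this
    simp [hxy]
  have hmono : 0 ≤ inner ℝ ((x - T x) - (y - T y)) (x - y) := by
    have e : (x - T x) - (y - T y) = (x - y) - (T x - T y) := by abel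
    rw [e, inner_sub_left, real_inner_self_eq_norm_sq]
    have := real_inner_le_norm (T x - T y) (x - y)
    nlinarith [hT x hx y hy, norm_nonneg (x - y)]
  have ht : 0 < t := hs.trans hlt
  have h1t : 0 ≤ 1 - t := by linarith
  have h1s : 0 ≤ 1 - s := by linarith
  have ex : (1 - t) • (x - T x) = t • (a - x) := by
    have : (1 - t) • T x = x - t • a := by
      nth_rewrite 2 [hxa]; abel
    rw [smul_sub, this]; module
  have ey : (1 - s) • (y - T y) = s • (a - y) := by
    have : (1 - s) • T y = y - s • a := by
      nth_rewrite 2 [hya]; abel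
    rw [smul_sub, this]; module
  have key : 0 ≤ inner ℝ (((1 - s) * t) • (a - x) - ((1 - t) * s) • (a - y)) (x - y) := by
    have e : ((1 - s) * t) • (a - x) - ((1 - t) * s) • (a - y)
        = ((1 - s) * (1 - t)) • ((x - T x) - (y - T y)) := by
      rw [mul_smul, mul_smul, ← ex, ← ey]; module
    rw [e, real_inner_smul_left]
    positivity
  have hxy : x - y = (a - y) - (a - x) := by abel
  rw [norm_sub_rev y a, norm_sub_rev x a, hxy]
  rw [hxy] at key
  generalize a - x = A at key ⊢
  generalize a - y = B at key ⊢
  have hBA := norm_sub_sq_real B A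
  rw [inner_sub_left, inner_sub_right, inner_sub_right, real_inner_smul_left,
    real_inner_smul_left, real_inner_smul_left, real_inner_smul_left,
    real_inner_self_eq_norm_sq, real_inner_self_eq_norm_sq, real_inner_comm B A] at key
  have hpos : 0 < t - s := by linarith
  have : 0 ≤ (t - s) * (inner ℝ B A - ‖A‖ ^ 2) := by
    have h2 : 0 ≤ (1 - t) * s * ‖B - A‖ ^ 2 := by positivity
    rw [hBA] at h2
    nlinarith
  have := nonneg_of_mul_nonneg_right this hpos
  linarith

/-! ### Intervals on which the implicit points are almost constant -/

theorem exists_browder_almost_constant [CompleteSpace H] {C : Set H} (hCclosed : IsClosed C)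
    (hCconvex : Convex ℝ C) {T : H → H} (hTC : Set.MapsTo T C C)
    (hT : ∀ x ∈ C, ∀ y ∈ C, ‖T x - T y‖ ≤ ‖x - y‖)
    {d : ℝ} (hd : ∀ x ∈ C, ∀ y ∈ C, ‖x - y‖ ≤ d) {a : H} (ha : a ∈ C)
    {s : ℕ → ℝ} (hs01 : ∀ n, s n ∈ Set.Ioc (0 : ℝ) 1)
    {δ : ℝ} (hδ : 0 ≤ δ) {M : ℕ} (hM : 0 < M) (hMδ : d ^ 2 ≤ M * δ ^ 2) :
    ∃ r < M, ∃ b ∈ C, ∀ t ∈ Set.Icc (s (r + 1)) (s r), ∀ x ∈ C,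
      x = (1 - t) • T x + t • a → ‖x - b‖ ≤ δ := by
  have hex : ∀ n, ∃ y ∈ C, y = (1 - s n) • T y + s n • a := fun n =>
    exists_convexCombination_fixedPoint hCclosed hCconvex hTC (S := fun _ => a)
      (fun _ _ => ha) le_rfl one_pos hT (by simp) ha (hs01 n)
  choose w hwC hw using hex
  -- the increments of the bounded sequence `‖w n - a‖²` cannot all exceed `δ²`
  obtain ⟨r, hr, hstep⟩ : ∃ r < M, ‖w (r + 1) - a‖ ^ 2 - ‖w r - a‖ ^ 2 ≤ δ ^ 2 := by
    by_contra! hcon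
    have hsum : ∑ r ∈ Finset.range M, δ ^ 2
        < ∑ r ∈ Finset.range M, (‖w (r + 1) - a‖ ^ 2 - ‖w r - a‖ ^ 2) :=
      Finset.sum_lt_sum_of_nonempty (by simpa using hM.ne')
        fun r hr => hcon r (Finset.mem_range.1 hr)
    rw [Finset.sum_range_sub (fun r => ‖w r - a‖ ^ 2)] at hsum
    simp only [Finset.sum_const, Finset.card_range, nsmul_eq_mul] at hsum
    have := pow_le_pow_left₀ (norm_nonneg _) (hd _ (hwC M) _ ha) 2
    linarith [sq_nonneg ‖w 0 - a‖]
  refine ⟨r, hr, w r, hwC r, fun t ht x hx hxa => ?_⟩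
  have ht1 : t ≤ 1 := ht.2.trans (hs01 r).2
  have ht0 : 0 < t := (hs01 (r + 1)).1.trans_le ht.1
  have h1 := norm_sq_browder_sub_le hT ht0 ht.2 (hs01 r).2 (hwC r) hx (hw r) hxa
  have h2 := norm_sq_browder_sub_le hT (hs01 (r + 1)).1 ht.1 ht1 hx (hwC (r + 1)) hxa (hw (r + 1))
  refine abs_le_of_sq_le_sq' ?_ hδ |>.2
  rw [norm_sub_rev]
  linarith [sq_nonneg ‖x - w (r + 1)‖]

/-- Each of the `L` levels replaces the approximation `b` by the almost constant value of the
Browder points with anchor `S b`, on one of `M` subintervals. -/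
theorem exists_implicit_almost_constant [CompleteSpace H] {C : Set H} (hCclosed : IsClosed C)
    (hCconvex : Convex ℝ C) {T S : H → H} (hTC : Set.MapsTo T C C) (hSC : Set.MapsTo S C C)
    {τ : ℝ} (hτ0 : 0 ≤ τ) (hτ1 : τ < 1)
    (hT : ∀ x ∈ C, ∀ y ∈ C, ‖T x - T y‖ ≤ ‖x - y‖)
    (hS : ∀ x ∈ C, ∀ y ∈ C, ‖S x - S y‖ ≤ τ * ‖x - y‖)
    {d : ℝ} (hd : ∀ x ∈ C, ∀ y ∈ C, ‖x - y‖ ≤ d)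
    {s : ℕ → ℝ} (hs : Antitone s) (hs01 : ∀ n, s n ∈ Set.Ioc (0 : ℝ) 1)
    {D : ℝ} (hD : 0 ≤ D) {M : ℕ} (hM : 0 < M) (hMD : d ^ 2 ≤ M * ((1 - τ) * D) ^ 2)
    {v : ℝ → H} (hvC : ∀ t ∈ Set.Ioc (0 : ℝ) 1, v t ∈ C)
    (hv : ∀ t ∈ Set.Ioc (0 : ℝ) 1, v t = (1 - t) • T (v t) + t • S (v t)) (L : ℕ) :
    ∀ (p : ℕ) (R : ℝ), ∀ b ∈ C,
      (∀ t ∈ Set.Icc (s (p + M ^ L)) (s p), ‖v t - b‖ ≤ R) →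
      ∃ j < M ^ L, ∃ b', ∀ t ∈ Set.Icc (s (p + j + 1)) (s (p + j)),
        ‖v t - b'‖ ≤ τ ^ L * (R - D) + D := by
  induction L with
  | zero =>
    intro p R b _ h
    exact ⟨0, by simp, b, fun t ht => by simpa using h t (by simpa using ht)⟩
  | succ L ih =>
    intro p R b hb h
    obtain ⟨r, hr, b₁, hb₁, hconst⟩ := exists_browder_almost_constant hCclosed hCconvex hTC hT hd
      (s := fun r => s (p + r * M ^ L)) (hSC hb) (fun _ => hs01 _) (mul_nonneg (by linarith) hD) hM hMD
    have hrM : (r + 1) * M ^ L ≤ M ^ (L + 1) := by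
      rw [pow_succ, mul_comm (M ^ L)]; exact Nat.mul_le_mul_right _ hr
    obtain ⟨j, hj, b₂, hb₂⟩ := ih (p + r * M ^ L) (τ * (R - D) + D) b₁ hb₁ (by
      intro t ht
      have ht01 : t ∈ Set.Ioc (0 : ℝ) 1 := ⟨(hs01 _).1.trans_le ht.1, ht.2.trans (hs01 _).2⟩
      have htR : ‖v t - b‖ ≤ R := by
        refine h t ⟨(hs ?_).trans ht.1, ht.2.trans (hs (Nat.le_add_right _ _))⟩
        linarith
      obtain ⟨x, hx, hxb⟩ := exists_convexCombination_fixedPoint hCclosed hCconvex hTC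
        (S := fun _ => S b) (fun _ _ => hSC hb) le_rfl one_pos hT (by simp) hb ht01
      have h1 := norm_browder_sub_le_of_anchors hT ht01 (hvC t ht01) hx (hv t ht01) hxb
      have h2 := hS _ (hvC t ht01) b hb
      have h3 : ‖x - b₁‖ ≤ (1 - τ) * D := by
        refine hconst t ⟨?_, ht.2⟩ x hx hxb
        have e : p + (r + 1) * M ^ L = p + r * M ^ L + M ^ L := by ring
        simpa only [e] using ht.1
      have h4 := norm_sub_le_norm_sub_add_norm_sub (v t) x b₁
      have h5 := mul_le_mul_of_nonneg_left htR hτ0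
      linarith)
    refine ⟨r * M ^ L + j, ?_, b₂, fun t ht => ?_⟩
    · refine lt_of_lt_of_le ?_ hrM
      rw [add_mul, one_mul]; exact Nat.add_lt_add_left hj _
    · have := hb₂ t (by simpa only [add_assoc] using ht)
      rw [pow_succ]
      linarith

/-! ### The explicit iteration tracks the implicit points -/

/-- The implicit points are Lipschitz in the parameter, with a constant that degenerates as the
parameter tends to `0`. -/
theorem norm_implicit_sub_le {C : Set H} {T S : H → H} (hTC : Set.MapsTo T C C)
    (hSC : Set.MapsTo S C C) {τ : ℝ}
    (hT : ∀ x ∈ C, ∀ y ∈ C, ‖T x - T y‖ ≤ ‖x - y‖)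
    (hS : ∀ x ∈ C, ∀ y ∈ C, ‖S x - S y‖ ≤ τ * ‖x - y‖)
    {d : ℝ} (hd : ∀ x ∈ C, ∀ y ∈ C, ‖x - y‖ ≤ d) {s t : ℝ} (ht : t ∈ Set.Ioc (0 : ℝ) 1)
    {x y : H} (hx : x ∈ C) (hy : y ∈ C)
    (hxs : x = (1 - s) • T x + s • S x) (hyt : y = (1 - t) • T y + t • S y) :
    t * (1 - τ) * ‖x - y‖ ≤ |s - t| * d := by
  have e : x - y = (((1 - t) • T x + t • S x) - ((1 - t) • T y + t • S y))
      + (s - t) • (S x - T x) := by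
    calc x - y = ((1 - s) • T x + s • S x) - ((1 - t) • T y + t • S y) := by rw [← hxs, ← hyt]
      _ = _ := by module
  have h1 : ‖x - y‖ ≤ (1 - t * (1 - τ)) * ‖x - y‖ + |s - t| * d := by
    calc ‖x - y‖ = ‖(((1 - t) • T x + t • S x) - ((1 - t) • T y + t • S y))
          + (s - t) • (S x - T x)‖ := by rw [← e]
      _ ≤ _ := norm_add_le _ _
      _ ≤ _ := by
        rw [norm_smul, Real.norm_eq_abs]
        exact add_le_add (norm_convexCombination_sub_le hT hS ht hx hy)
          (mul_le_mul_of_nonneg_left (hd _ (hSC hx) _ (hTC hx)) (abs_nonneg _))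
  linarith

theorem le_exp_mul_add_of_recursion {a : ℕ → ℝ} {l : ℕ → ℝ} {q B η : ℝ} {m : ℕ}
    (hB : 0 ≤ B) (ha : a m ≤ B + η) (hlq : ∀ n, l n * q ≤ 1)
    (hrec : ∀ n, m ≤ n → a (n + 1) ≤ (1 - l (n + 1) * q) * a n + l (n + 1) * q * η)
    {n : ℕ} (hmn : m ≤ n) :
    a n ≤ Real.exp (-(q * ∑ i ∈ Finset.Ioc m n, l i)) * B + η := by
  induction n, hmn using Nat.le_induction with
  | base => simpa using ha
  | succ n hmn ih =>
    have h0 : 0 ≤ 1 - l (n + 1) * q := by linarith [hlq (n + 1)]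
    have h1 := Real.add_one_le_exp (-(l (n + 1) * q))
    rw [← Finset.insert_Ioc_right_eq_Ioc_add_one hmn, Finset.sum_insert (by simp)]
    have e : -(q * (l (n + 1) + ∑ i ∈ Finset.Ioc m n, l i))
        = -(l (n + 1) * q) + -(q * ∑ i ∈ Finset.Ioc m n, l i) := by ring
    rw [e, Real.exp_add]
    set E := Real.exp (-(q * ∑ i ∈ Finset.Ioc m n, l i))
    have hE : 0 ≤ E * B := mul_nonneg (Real.exp_pos _).le hB
    have h2 := mul_le_mul_of_nonneg_left ih h0
    have h3 := mul_le_mul_of_nonneg_right h1 hE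
    linarith [hrec n hmn]

theorem norm_sub_implicit_le {C : Set H} {T S : H → H} (hTC : Set.MapsTo T C C)
    (hSC : Set.MapsTo S C C) {τ : ℝ} (hτ0 : 0 ≤ τ) (hτ1 : τ < 1)
    (hT : ∀ x ∈ C, ∀ y ∈ C, ‖T x - T y‖ ≤ ‖x - y‖)
    (hS : ∀ x ∈ C, ∀ y ∈ C, ‖S x - S y‖ ≤ τ * ‖x - y‖)
    {d : ℕ} (hd1 : 1 ≤ d) (hd : ∀ x ∈ C, ∀ y ∈ C, ‖x - y‖ ≤ (d : ℝ))
    {l : ℕ → ℝ} (hl : ∀ n, l n ∈ Set.Ioc (0 : ℝ) 1)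
    {φ₁ : ℝ → ℕ} (hφ₁ : ∀ k : ℝ, 0 < k → k ≤ ∑ i ∈ Finset.Icc 1 (φ₁ k), l i)
    {φ₂ : ℝ → ℕ}
    (hφ₂ : ∀ ε : ℝ, 0 < ε → ∀ n, φ₂ ε ≤ n → |l n - l (n + 1)| / l (n + 1) ^ 2 ≤ ε)
    {u : ℕ → H} (huC : ∀ n, u n ∈ C)
    (hu : ∀ n, u (n + 1) = (1 - l (n + 1)) • T (u n) + l (n + 1) • S (u n))
    {v : ℕ → H} (hvC : ∀ n, v n ∈ C) (hv : ∀ n, v n = (1 - l n) • T (v n) + l n • S (v n))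
    {ε : ℝ} (hε0 : 0 < ε) (hε1 : ε ≤ 1) {n : ℕ} (hn : shiftConst τ ε d φ₁ φ₂ ≤ n) :
    ‖u n - v n‖ ≤ ε / 3 := by
  have hq : 0 < 1 - τ := by linarith
  have hdR : (1 : ℝ) ≤ d := by exact_mod_cast hd1
  have hd0 : (0 : ℝ) < d := by linarith
  set m := φ₂ ((1 - τ) ^ 2 * ε / (6 * (d : ℝ))) with hm
  have hlog : 0 < Real.log (6 * (d : ℝ) / ε) := by
    apply Real.log_pos
    rw [lt_div_iff₀ hε0]; linarith
  set k := ((m : ℝ) + Real.log (6 * (d : ℝ) / ε)) / (1 - τ) with hk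
  have hk0 : 0 < k := by positivity
  have hkn : k ≤ ∑ i ∈ Finset.Icc 1 n, l i :=
    (hφ₁ k hk0).trans (Finset.sum_le_sum_of_subset_of_nonneg
      (Finset.Icc_subset_Icc le_rfl hn) fun i _ _ => (hl i).1.le)
  have hmk : (m : ℝ) + Real.log (6 * (d : ℝ) / ε) / (1 - τ) ≤ k := by
    rw [hk, add_div]
    gcongr
    rw [le_div_iff₀ hq]
    nlinarith [(Nat.cast_nonneg m : (0 : ℝ) ≤ m)]
  have hcard : ∀ N : ℕ, ∑ i ∈ Finset.Icc 1 N, l i ≤ N := fun N => by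
    simpa using Finset.sum_le_card_nsmul (Finset.Icc 1 N) l 1 fun i _ => (hl i).2
  have hmn : m ≤ n := by
    have h1 := hcard n
    have h2 : 0 < Real.log (6 * (d : ℝ) / ε) / (1 - τ) := by positivity
    have : (m : ℝ) ≤ n := by linarith
    exact_mod_cast this
  have hsum : Real.log (6 * (d : ℝ) / ε) ≤ (1 - τ) * ∑ i ∈ Finset.Ioc m n, l i := by
    have hsplit : ∑ i ∈ Finset.Icc 1 n, l i
        = ∑ i ∈ Finset.Icc 1 m, l i + ∑ i ∈ Finset.Ioc m n, l i := by
      have h0 : ∀ N, Finset.Icc 1 N = Finset.Ioc 0 N := fun N => by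
        ext i; simp [Nat.succ_le_iff]
      rw [h0, h0, Finset.sum_Ioc_consecutive _ (Nat.zero_le _) hmn]
    have h1 := hcard m
    have h2 : Real.log (6 * (d : ℝ) / ε) / (1 - τ) ≤ ∑ i ∈ Finset.Ioc m n, l i := by linarith
    rw [div_le_iff₀ hq] at h2
    linarith
  have hrec : ∀ j, m ≤ j → ‖u (j + 1) - v (j + 1)‖
      ≤ (1 - l (j + 1) * (1 - τ)) * ‖u j - v j‖ + l (j + 1) * (1 - τ) * (ε / 6) := by
    intro j hj
    have hl' := hl (j + 1)
    have hl2 : 0 < l (j + 1) ^ 2 := pow_pos hl'.1 2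
    have h1 := norm_convexCombination_sub_le hT hS hl' (huC j) (hvC (j + 1))
    rw [← hu, ← hv] at h1
    have h2 := norm_implicit_sub_le hTC hSC hT hS hd hl' (hvC j) (hvC (j + 1)) (hv j) (hv (j + 1))
    have h3 := hφ₂ ((1 - τ) ^ 2 * ε / (6 * (d : ℝ))) (by positivity) j hj
    rw [div_le_iff₀ hl2] at h3
    have h4 : ‖v j - v (j + 1)‖ ≤ l (j + 1) * (1 - τ) * (ε / 6) := by
      have hc : 0 < l (j + 1) * (1 - τ) := mul_pos hl'.1 hq
      refine le_of_mul_le_mul_left (h2.trans ((mul_le_mul_of_nonneg_right h3 hd0.le).trans ?_)) hc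
      apply le_of_eq
      field_simp
    have h5 := norm_sub_le_norm_sub_add_norm_sub (u j) (v j) (v (j + 1))
    have h6 : 0 ≤ 1 - l (j + 1) * (1 - τ) := by nlinarith [hl'.1, hl'.2]
    have h7 : (1 - l (j + 1) * (1 - τ)) * ‖v j - v (j + 1)‖ ≤ ‖v j - v (j + 1)‖ := by
      nlinarith [norm_nonneg (v j - v (j + 1)), mul_pos hl'.1 hq]
    have h8 := mul_le_mul_of_nonneg_left h5 h6
    linarith
  have hmain := le_exp_mul_add_of_recursion (a := fun j => ‖u j - v j‖) (l := l) (q := 1 - τ)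
    (B := d) (η := ε / 6) (m := m) hd0.le (by linarith [hd _ (huC m) _ (hvC m)])
    (fun j => by nlinarith [(hl j).1, (hl j).2]) hrec hmn
  have hexp : Real.exp (-((1 - τ) * ∑ i ∈ Finset.Ioc m n, l i)) ≤ ε / (6 * d) := by
    calc _ ≤ Real.exp (-Real.log (6 * (d : ℝ) / ε)) := Real.exp_le_exp.2 (by linarith)
      _ = ε / (6 * d) := by
        rw [Real.exp_neg, Real.exp_log (by positivity), inv_div]
  have h1 := mul_le_mul_of_nonneg_right hexp hd0.le
  have h2 : ε / (6 * (d : ℝ)) * d = ε / 6 := by field_simp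
  have h3 : ‖u n - v n‖ ≤ _ := hmain
  linarith

end Hilbert

/-! ### Growth of the bounding functions -/

theorem le_runMax (φ : ℕ → ℕ) {i n : ℕ} (h : i ≤ n) : φ i ≤ runMax φ n :=
  Finset.le_sup (f := φ) (Finset.mem_range.2 (Nat.lt_succ_of_le h))

theorem monotone_tilde (d : ℕ) (φ : ℕ → ℕ) : Monotone (tilde d φ) := fun m n hmn => by
  have h : 16 * d * m ^ 2 ≤ 16 * d * n ^ 2 := by gcongr
  exact max_le_max (Finset.sup_mono (Finset.Icc_subset_Icc le_rfl h)) h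

theorem le_tilde {d : ℕ} (hd : 1 ≤ d) (φ : ℕ → ℕ) (n : ℕ) : n ≤ tilde d φ n := by
  refine le_trans ?_ (le_max_right _ _)
  nlinarith [Nat.le_self_pow two_ne_zero n]

theorem apply_le_tilde {d : ℕ} (hd : 1 ≤ d) (φ : ℕ → ℕ) {n : ℕ} (hn : 1 ≤ n) :
    φ n ≤ tilde d φ n := by
  refine le_trans ?_ (le_max_left _ _)
  refine Finset.le_sup (f := φ) (Finset.mem_Icc.2 ⟨hn, ?_⟩)
  nlinarith [Nat.le_self_pow two_ne_zero n]

theorem le_iterate_tilde {d : ℕ} (hd : 1 ≤ d) (φ : ℕ → ℕ) (n j : ℕ) :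
    n ≤ (tilde d φ)^[j] n :=
  Function.id_le_iterate_of_id_le (le_tilde hd φ) j n

theorem iterate_le_iterate_tilde {d : ℕ} (hd : 1 ≤ d) {φ : ℕ → ℕ} (hφ : Monotone φ) {n : ℕ}
    (hn : 1 ≤ n) (j : ℕ) : φ^[j] n ≤ (tilde d φ)^[j] n := by
  induction j with
  | zero => rfl
  | succ j ih =>
    rw [Function.iterate_succ_apply', Function.iterate_succ_apply']
    exact (hφ ih).trans (apply_le_tilde hd φ (hn.trans (le_iterate_tilde hd φ n j)))

theorem iterate_le_kSeq {d : ℕ} (hd : 1 ≤ d) (N : ℕ) {F : ℕ → ℕ} (hF : Monotone F) (i : ℕ) :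
    F^[N ^ max i 1] 1 ≤ kSeq N d F i := by
  have hpos : ∀ i, 1 ≤ kSeq N d F i := fun i => by
    induction i with
    | zero => exact le_iterate_tilde hd _ _ _
    | succ i ih => exact ih.trans (le_iterate_tilde hd _ _ _)
  cases i with
  | zero => simpa [kSeq] using iterate_le_iterate_tilde hd hF le_rfl N
  | succ i =>
    have h := iterate_le_iterate_tilde hd (hF.iterate (N ^ i)) (hpos i) N
    rw [← Function.iterate_mul, ← pow_succ] at h
    rw [max_eq_left (Nat.le_add_left 1 i)]
    exact (hF.iterate _ (hpos i)).trans h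

theorem runMax_le_fMaj {τ ε : ℝ} (hτ0 : 0 ≤ τ) (hτ1 : τ < 1) (hε0 : 0 < ε) (hε1 : ε ≤ 1)
    (g χ h : ℕ → ℕ) {d : ℕ} (hd : 1 ≤ d) (n : ℕ) :
    runMax h (runMax (gTilde g) (χ (d * n))) ≤ fMaj τ ε g χ h d n := by
  have hq : 0 < 1 - τ := by linarith
  have hdR : (1 : ℝ) ≤ d := by exact_mod_cast hd
  set X := runMax h (runMax (gTilde g) (χ (d * n)))
  suffices hX : (X : ℝ) ≤ fMaj τ ε g χ h d n by exact_mod_cast hX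
  refine le_trans ?_ (Nat.le_ceil _)
  rw [le_div_iff₀ (by positivity)]
  have h1 : (1 - τ) * (ε / 2) ^ 2 ≤ 1 :=
    mul_le_one₀ (by linarith) (by positivity) (pow_le_one₀ (by positivity) (by linarith))
  have h2 : (0 : ℝ) ≤ X := Nat.cast_nonneg _
  nlinarith [mul_le_mul_of_nonneg_left h1 h2, mul_le_mul_of_nonneg_right hdR h2]

section Constants

variable {τ ε : ℝ} {d : ℕ}

theorem epsTilde_pos (hτ1 : τ < 1) (hε0 : 0 < ε) (hd : 1 ≤ d) : 0 < epsTilde τ ε d := by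
  have hq : 0 < 1 - τ := by linarith
  have hd0 : (0 : ℝ) < d := by exact_mod_cast hd
  unfold epsTilde epsD
  positivity

theorem epsTilde_le (hτ1 : τ < 1) (hε0 : 0 < ε) (hd : 1 ≤ d) :
    epsTilde τ ε d ≤ ((1 - τ) * ε) ^ 4 / 64 := by
  have hq : 0 < 1 - τ := by linarith
  have hd0 : (1 : ℝ) ≤ d := by exact_mod_cast hd
  have e : epsTilde τ ε d = ((1 - τ) * ε) ^ 4 / ((6 + 8 * (d : ℝ)) * (16 * (8 * (d : ℝ) ^ 2))) := by
    unfold epsTilde epsD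
    field_simp
    ring
  rw [e]
  refine div_le_div_of_nonneg_left (by positivity) (by norm_num) ?_
  nlinarith [one_le_pow₀ hd0 (n := 2)]

/-- The pigeonhole needs `d² / ((1 - τ) ε / 2)²` parts; a square root of `numIter` is enough. -/
theorem exists_parts (hτ0 : 0 ≤ τ) (hτ1 : τ < 1) (hε0 : 0 < ε) (hε1 : ε ≤ 1) (hd : 1 ≤ d) :
    ∃ M : ℕ, 0 < M ∧ (d : ℝ) ^ 2 ≤ M * ((1 - τ) * (ε / 2)) ^ 2 ∧ M ^ 2 ≤ numIter τ ε d := by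
  have hq : 0 < 1 - τ := by linarith
  have hdR : (1 : ℝ) ≤ d := by exact_mod_cast hd
  set y := (1 - τ) * ε with hy
  have hy0 : 0 < y := by positivity
  have hy1 : y ≤ 1 := mul_le_one₀ (by linarith) hε0.le hε1
  have hp := epsTilde_pos hτ1 hε0 hd
  have hle := epsTilde_le hτ1 hε0 hd
  have hy4 : y ^ 4 ≤ 1 := pow_le_one₀ hy0.le hy1
  set X := 4 * (d : ℝ) ^ 2 / y ^ 2 with hX
  have hX1 : 1 ≤ X := by
    rw [hX, one_le_div (by positivity)]
    nlinarith [one_le_pow₀ hdR (n := 2), pow_le_one₀ hy0.le hy1 (n := 2)]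
  refine ⟨⌈X⌉₊, Nat.ceil_pos.2 (by linarith), ?_, ?_⟩
  · have e : (1 - τ) * (ε / 2) = y / 2 := by rw [hy]; ring
    calc (d : ℝ) ^ 2 = X * (y / 2) ^ 2 := by rw [hX]; field_simp; norm_num
      _ ≤ ⌈X⌉₊ * (y / 2) ^ 2 := by gcongr; exact Nat.le_ceil _
      _ = _ := by rw [e]
  · have hM : (⌈X⌉₊ : ℝ) ≤ 2 * X := by linarith [Nat.ceil_lt_add_one (show 0 ≤ X by linarith)]
    suffices hs : ((⌈X⌉₊ : ℝ)) ^ 2 ≤ numIter τ ε d by exact_mod_cast hs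
    refine le_trans ?_ (Nat.le_ceil _)
    calc (⌈X⌉₊ : ℝ) ^ 2 ≤ (2 * X) ^ 2 := by gcongr
      _ = 8 * (d : ℝ) ^ 4 / (y ^ 4 / 8) := by rw [hX]; field_simp; norm_num
      _ ≤ 8 * (d : ℝ) ^ 4 / epsTilde τ ε d ^ 4 := by
        refine div_le_div_of_nonneg_left (by positivity) (by positivity) ?_
        have h1 : epsTilde τ ε d ^ 4 ≤ epsTilde τ ε d :=
          pow_le_of_le_one hp.le (by linarith) (by norm_num)
        linarith [pow_pos hy0 4]

theorem pow_depth_mul_le (hτ0 : 0 ≤ τ) (hτ1 : τ < 1) (hε0 : 0 < ε) (hε1 : ε ≤ 1) (hd : 1 ≤ d) :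
    τ ^ (depth τ ε d + 1) * d ≤ ε / 2 := by
  have hdR : (1 : ℝ) ≤ d := by exact_mod_cast hd
  have hp := epsTilde_pos hτ1 hε0 hd
  have hle := epsTilde_le hτ1 hε0 hd
  rcases hτ0.eq_or_lt with rfl | hτ
  · simp; positivity
  set x := epsTilde τ ε d / (6 * (d : ℝ) ^ 2) with hx
  have hx0 : 0 < x := by positivity
  have h1 : Real.logb τ x ≤ ((depth τ ε d + 1 : ℕ) : ℝ) := by
    have := Nat.le_ceil (Real.logb τ x - 1)
    push_cast
    unfold depth
    linarith
  have h2 : τ ^ (depth τ ε d + 1) ≤ x := by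
    rwa [Real.logb_le_iff_le_rpow_of_base_lt_one hτ hτ1 hx0, Real.rpow_natCast] at h1
  have h3 : ((1 - τ) * ε) ^ 4 ≤ ε := by
    have h0 : (1 - τ) * ε ≤ ε := by nlinarith
    calc ((1 - τ) * ε) ^ 4 ≤ ε ^ 4 := by
          have : 0 ≤ (1 - τ) * ε := mul_nonneg (by linarith) hε0.le
          gcongr
      _ ≤ ε := pow_le_of_le_one hε0.le hε1 (by norm_num)
  calc τ ^ (depth τ ε d + 1) * d ≤ x * d := by gcongr
    _ = epsTilde τ ε d / (6 * d) := by rw [hx]; field_simp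
    _ ≤ epsTilde τ ε d := div_le_self hp.le (by linarith)
    _ ≤ ε / 2 := by linarith

theorem pow_parts_le {M N : ℕ} (hM : 0 < M) (hMN : M ^ 2 ≤ N) (i : ℕ) :
    M ^ (i + 1) ≤ N ^ max i 1 := by
  calc M ^ (i + 1) ≤ M ^ (2 * max i 1) := Nat.pow_le_pow_right hM (by omega)
    _ = (M ^ 2) ^ max i 1 := pow_mul _ _ _
    _ ≤ N ^ max i 1 := Nat.pow_le_pow_left hMN _

end Constants

end HSDM

/-! ### Metastability of the explicit iteration -/

theorem mainTheorem2
    {H : Type*} [NormedAddCommGroup H] [InnerProductSpace ℝ H] [CompleteSpace H]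
    (d : ℕ) (hd : 1 ≤ d)
    (C : Set H) (hCclosed : IsClosed C) (hCconvex : Convex ℝ C)
    (hCbdd : Bornology.IsBounded C) (hCdiam : Metric.diam C ≤ (d : ℝ))
    (T : H → H) (hTC : Set.MapsTo T C C)
    (hT : ∀ x ∈ C, ∀ y ∈ C, ‖T x - T y‖ ≤ ‖x - y‖)
    (G : H → H) (hGC : Set.MapsTo G C C)
    (τ : ℝ) (hτ0 : 0 ≤ τ) (hτ1 : τ < 1)
    (hG : ∀ x ∈ C, ∀ y ∈ C, ‖G x - G y‖ ≤ τ * ‖x - y‖)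
    (l : ℕ → ℝ) (hlpos : ∀ n, 0 < l n) (hlle : ∀ n, l n ≤ 1)
    (h : ℕ → ℕ) (hhpos : ∀ n, 1 ≤ h n) (hh : ∀ n, 1 / (h n : ℝ) ≤ l n)
    (χ : ℕ → ℕ) (hχ : ∀ n i, χ n ≤ i → l i ≤ 1 / ((n : ℝ) + 1))
    (φ₁ : ℝ → ℕ) (hφ₁ : ∀ k : ℝ, 0 < k → k ≤ ∑ i ∈ Finset.Icc 1 (φ₁ k), l i)
    (φ₂ : ℝ → ℕ)
    (hφ₂ : ∀ ε : ℝ, 0 < ε → ∀ n, φ₂ ε ≤ n → |l n - l (n + 1)| / l (n + 1) ^ 2 ≤ ε)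
    (u : ℕ → H) (hu0 : u 0 ∈ C)
    (hu : ∀ n, u (n + 1) = (1 - l (n + 1)) • T (u n) + l (n + 1) • G (T (u n)))
    (ε : ℝ) (hε0 : 0 < ε) (hε1 : ε ≤ 1) (g : ℕ → ℕ) :
    ∃ n : ℕ,
      n ≤ HSDM.Xi τ (ε / 6) (HSDM.shiftFun (HSDM.shiftConst τ ε d φ₁ φ₂) g) χ h d
          + HSDM.shiftConst τ ε d φ₁ φ₂ ∧
      ∀ i ∈ Set.Icc n (n + g n), ∀ j ∈ Set.Icc n (n + g n), ‖u i - u j‖ ≤ ε := by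

  have hdR : (1 : ℝ) ≤ d := by exact_mod_cast hd
  have hdiam : ∀ x ∈ C, ∀ y ∈ C, ‖x - y‖ ≤ (d : ℝ) := fun x hx y hy => by
    rw [← dist_eq_norm]
    exact (Metric.dist_le_diam_of_mem hCbdd hx hy).trans hCdiam
  have hl : ∀ n, l n ∈ Set.Ioc (0 : ℝ) 1 := fun n => ⟨hlpos n, hlle n⟩
  set S : H → H := fun x => G (T x)
  have hSC : Set.MapsTo S C C := fun x hx => hGC (hTC hx)
  have hS : ∀ x ∈ C, ∀ y ∈ C, ‖S x - S y‖ ≤ τ * ‖x - y‖ := fun x hx y hy =>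
    (hG _ (hTC hx) _ (hTC hy)).trans (mul_le_mul_of_nonneg_left (hT x hx y hy) hτ0)
  have huC : ∀ n, u n ∈ C := fun n => by
    induction n with
    | zero => exact hu0
    | succ n ih => rw [hu]; exact HSDM.mapsTo_convexCombination hCconvex hTC hSC (hl (n + 1)) ih
  have hex : ∀ t : ℝ, ∃ y, t ∈ Set.Ioc (0 : ℝ) 1 → y ∈ C ∧ y = (1 - t) • T y + t • S y := by
    intro t
    by_cases ht : t ∈ Set.Ioc (0 : ℝ) 1
    · obtain ⟨y, hy⟩ := HSDM.exists_convexCombination_fixedPoint hCclosed hCconvex hTC hSC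
        hτ0 hτ1 hT hS hu0 ht
      exact ⟨y, fun _ => hy⟩
    · exact ⟨0, fun h => absurd h ht⟩
  choose v hv using hex
  set c := HSDM.shiftConst τ ε d φ₁ φ₂
  set N := HSDM.numIter τ (ε / 6) d
  set F := HSDM.tilde d (HSDM.fMaj τ (ε / 6) (HSDM.shiftFun c g) χ h d)
  set i₀ := HSDM.depth τ (ε / 6) d
  have hε60 : 0 < ε / 6 := by positivity
  have hε61 : ε / 6 ≤ 1 := by linarith
  have hFmono : Monotone F := HSDM.monotone_tilde d _
  have hFid : ∀ n, n ≤ F n := HSDM.le_tilde hd _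
  have hkpos : ∀ j, 1 ≤ F^[j] 1 := HSDM.le_iterate_tilde hd _ 1
  have hkmono : Monotone fun j => F^[j] 1 := monotone_nat_of_le_succ fun j => by
    rw [Function.iterate_succ_apply']; exact hFid _
  have hs : Antitone fun j => 1 / ((F^[j] 1 : ℕ) : ℝ) := fun i j hij =>
    one_div_le_one_div_of_le (by exact_mod_cast hkpos i) (by exact_mod_cast hkmono hij)
  have hs01 : ∀ j, 1 / ((F^[j] 1 : ℕ) : ℝ) ∈ Set.Ioc (0 : ℝ) 1 := fun j => by
    have h1 : (1 : ℝ) ≤ (F^[j] 1 : ℕ) := by exact_mod_cast hkpos j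
    exact ⟨by positivity, (div_le_one (by linarith)).2 h1⟩
  obtain ⟨M, hM, hMD, hMN⟩ := HSDM.exists_parts hτ0 hτ1 hε60 hε61 hd
  obtain ⟨j, hj, b, hb⟩ := HSDM.exists_implicit_almost_constant hCclosed hCconvex hTC hSC
    hτ0 hτ1 hT hS hdiam hs hs01 (by positivity) hM hMD (fun t ht => (hv t ht).1)
    (fun t ht => (hv t ht).2) (i₀ + 1) 0 d (u 0) hu0
    (fun t ht => hdiam _ (hv t ⟨(hs01 _).1.trans_le ht.1, ht.2.trans (hs01 _).2⟩).1 _ hu0)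
  simp only [zero_add] at hb
  have hbound : τ ^ (i₀ + 1) * ((d : ℝ) - ε / 6 / 2) + ε / 6 / 2 ≤ ε / 6 := by
    have h1 := HSDM.pow_depth_mul_le hτ0 hτ1 hε60 hε61 hd
    have h2 : 0 ≤ τ ^ (i₀ + 1) * (ε / 6 / 2) := by positivity
    linarith
  set K := HSDM.kSeq N d F i₀
  have hjK : F^[j] 1 ≤ K :=
    (hkmono (hj.le.trans (HSDM.pow_parts_le hM hMN i₀))).trans
      (HSDM.iterate_le_kSeq hd N hFmono i₀)
  -- the rate `χ` need not be monotone, so the smaller of two admissible indices is taken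
  set n := min (χ (d * F^[j] 1)) (χ (d * K))
  have hmem : ∀ i ∈ Set.Icc (n + c) (n + c + g (n + c)), ‖v (l i) - b‖ ≤ ε / 6 := by
    intro i hi
    refine (hb (l i) ⟨?_, ?_⟩).trans hbound
    · have h1 : i ≤ HSDM.runMax (HSDM.gTilde (HSDM.shiftFun c g)) (χ (d * F^[j] 1)) :=
        (hi.2.trans (le_max_right n _)).trans
          (HSDM.le_runMax (HSDM.gTilde (HSDM.shiftFun c g)) (min_le_left _ _))
      have h2 : h i ≤ F^[j + 1] 1 := by
        rw [Function.iterate_succ_apply']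
        exact ((HSDM.le_runMax h h1).trans
          (HSDM.runMax_le_fMaj hτ0 hτ1 hε60 hε61 _ _ _ hd _)).trans
          (HSDM.apply_le_tilde hd _ (hkpos j))
      have h3 : (0 : ℝ) < h i := by exact_mod_cast hhpos i
      exact (one_div_le_one_div_of_le h3 (by exact_mod_cast h2)).trans (hh i)
    · have hni : n ≤ i := (Nat.le_add_right n c).trans hi.1
      have h0 : (0 : ℝ) < (F^[j] 1 : ℕ) := by exact_mod_cast hkpos j
      have hle : ∀ m, F^[j] 1 ≤ m → χ (d * m) ≤ i → l i ≤ 1 / ((F^[j] 1 : ℕ) : ℝ) := by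
        intro m hm hi'
        refine (hχ _ _ hi').trans (one_div_le_one_div_of_le h0 ?_)
        have : F^[j] 1 ≤ d * m + 1 := by nlinarith
        exact_mod_cast this
      rcases min_le_iff.1 hni with h1 | h1
      · exact hle _ le_rfl h1
      · exact hle _ hjK h1
  have htrack : ∀ i, n + c ≤ i → ‖u i - v (l i)‖ ≤ ε / 3 := fun i hi =>
    HSDM.norm_sub_implicit_le hTC hSC hτ0 hτ1 hT hS hd hdiam hl hφ₁ hφ₂ huC hu
      (v := fun n => v (l n)) (fun n => (hv _ (hl n)).1) (fun n => (hv _ (hl n)).2) hε0 hε1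
      ((Nat.le_add_left c n).trans hi)
  have hu_near : ∀ i ∈ Set.Icc (n + c) (n + c + g (n + c)), ‖u i - b‖ ≤ ε / 2 := fun i hi => by
    have h1 := norm_sub_le_norm_sub_add_norm_sub (u i) (v (l i)) b
    linarith [htrack i hi.1, hmem i hi]
  refine ⟨n + c, Nat.add_le_add_right (min_le_right _ _) c, fun i hi j hj => ?_⟩
  have h1 := norm_sub_le_norm_sub_add_norm_sub (u i) b (u j)
  rw [norm_sub_rev b] at h1
  linarith [hu_near i hi, hu_near j hj]
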